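/- Let $G$ be a connected nilpotent (finite-dimensional real) Lie group and let $V$ be a finite-dimensional real $G$-module, i.e. a finite-dimensional real vector space with a smooth linear representation of $G$. Suppose that $V$ is of unipotent type: every element of the Lie algebra $\mathfrak g$ of $G$ acts on $V$, through the derivative of the representation at the identity, by a nilpotent operator. Let $V^*$ be the group of continuous characters $V\to\mathbb T$ of the additive group $V$, and let $bV$ be the Bohr compactification of $V$, i.e. the Pontryagin dual of $V^*$ with the discrete topology; the Bohr topology of $V$ is the topology induced by the map $V\to bV$, $v\mapsto(\chi\mapsto\chi(v))$. Then for every $v\in V$ the orbit $Gv$ is Bohr dense in its (real) affine hull: the closure of $Gv$ in the Bohr topology of $V$ contains the affine hull of $Gv$. -/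

import Mathlib

open scoped Manifold ContDiff

namespace Bohr

noncomputable section

/-- The Pontryagin dual `V^*` of the additive topological group `V`, as a group. It is made into
a topological group below by means of the discrete topology. -/
def DiscreteDual (V : Type*) [AddCommGroup V] [TopologicalSpace V] : Type _ :=
  PontryaginDual (Multiplicative V)

instance (V : Type*) [AddCommGroup V] [TopologicalSpace V] : CommGroup (DiscreteDual V) :=
  inferInstanceAs (CommGroup (PontryaginDual (Multiplicative V)))

instance (V : Type*) [AddCommGroup V] [TopologicalSpace V] : TopologicalSpace (DiscreteDual V) :=
  ⊥

instance (V : Type*) [AddCommGroup V] [TopologicalSpace V] : DiscreteTopology (DiscreteDual V) :=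
  ⟨rfl⟩

/-- The Bohr compactification `bV`: the Pontryagin dual of the discretized group `V^*`. -/
abbrev Compactification (V : Type*) [AddCommGroup V] [TopologicalSpace V] : Type _ :=
  PontryaginDual (DiscreteDual V)

/-- Evaluation of a continuous character of `V` at a vector. -/
def DiscreteDual.eval {V : Type*} [AddCommGroup V] [TopologicalSpace V]
    (χ : DiscreteDual V) (v : V) : Circle :=
  (show PontryaginDual (Multiplicative V) from χ) (Multiplicative.ofAdd v)

/-- The canonical map `V → bV`, sending `v` to the character `χ ↦ χ v` of `V^*`. -/
def toCompactification (V : Type*) [AddCommGroup V] [TopologicalSpace V] (v : V) :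
    Compactification V :=
  show DiscreteDual V →ₜ* Circle from
  { toFun := fun χ => χ.eval v
    map_one' := rfl
    map_mul' := fun _ _ => rfl
    continuous_toFun := continuous_of_discreteTopology }

/-- The Bohr topology of `V`: the relative topology of `V` in `bV`. -/
abbrev bohrTopology (V : Type*) [AddCommGroup V] [TopologicalSpace V] : TopologicalSpace V :=
  TopologicalSpace.induced (toCompactification V) inferInstance

/-- The subset `O` of `A` is Bohr dense in `A`: its closure for the Bohr topology of `V`
contains `A`. -/
def IsBohrDenseIn {V : Type*} [AddCommGroup V] [TopologicalSpace V] (O A : Set V) : Prop :=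
  O ⊆ A ∧ A ⊆ @closure V (bohrTopology V) O

section Module

variable {E : Type*} [NormedAddCommGroup E] [NormedSpace ℝ E]
  {G : Type*} [TopologicalSpace G] [ChartedSpace E G] [Group G]
  {V : Type*} [NormedAddCommGroup V] [NormedSpace ℝ V] [FiniteDimensional ℝ V]

/-- A representation of `G` on a finite-dimensional space, seen as a map into the normed space
of endomorphisms of `V`. -/
def operatorMap (ρ : Representation ℝ G V) (g : G) : V →L[ℝ] V :=
  LinearMap.toContinuousLinearMap (ρ g)

variable (E) in
/-- The action of the Lie group `G` on `V` is smooth, i.e. `V` is a module of the Lie group `G`. -/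
def IsSmoothModule (ρ : Representation ℝ G V) : Prop :=
  ContMDiff 𝓘(ℝ, E) 𝓘(ℝ, V →L[ℝ] V) ∞ (operatorMap ρ)

/-- The operator by which an element `X` of the Lie algebra `T₁G` of `G` acts on `V`: the
derivative at the identity of the representation, in the direction `X`. -/
def lieAlgebraAction (ρ : Representation ℝ G V) (X : GroupLieAlgebra 𝓘(ℝ, E) G) : V →L[ℝ] V :=
  mfderiv 𝓘(ℝ, E) 𝓘(ℝ, V →L[ℝ] V) (operatorMap ρ) (1 : G) X

variable (E) in
/-- `V` is of unipotent type: the Lie algebra of `G` acts by nilpotent operators. -/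
def IsUnipotentType (ρ : Representation ℝ G V) : Prop :=
  ∀ X : GroupLieAlgebra 𝓘(ℝ, E) G, IsNilpotent (lieAlgebraAction ρ X)

end Module

end

end Bohr

/-!
A unipotent module is an algebraic object: if `A` is the operator by which an element of the Lie
algebra acts, then `A` is nilpotent, so `t ↦ exp (t A) v` is a polynomial curve. The proof reduces
the density of the orbit to the density of polynomial curves.

*Polynomial curves are Bohr dense in their affine hulls*
(`IsPolynomialCurve.affineSpan_subset_bohr_closure`). Every continuous character of `V` has the form
`exp (i l)` with `l` a linear functional, so along a polynomial curve the characters become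
functions `exp (i q(t))` with `q` a real polynomial. The mean over `[0, T]` of such a function
tends to `0` unless `q` is constant (`tendsto_mean_phase`). This gives a version of Kronecker's
theorem (`exists_norm_phase_sub_one_lt`): polynomials without nonzero constant integral
combinations have phases that are simultaneously close to `0` modulo `2π`. For a point `w` of the
affine hull of a curve `u`, the polynomials `l (u t) - l w` satisfy this condition, because a
functional that is constant on the curve has the same value at `w`.

*One curve suffices.* Let `K` be the norm closure of the image of `G` in the endomorphisms of `V`;
the norm closure of an orbit lies in its Bohr closure. By the product formula `tendsto_pow_exp`, the
monoid `K` contains `exp A` for all `A` coming from the Lie algebra. Products of factors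
`exp (p(t) A)` with `p` a polynomial carry constants to polynomial curves, and with Lagrange
interpolation one such product passes through any finitely many prescribed products of exponentials
(`exists_polynomialFamily_through`). Hence the Bohr closure of the orbit contains the affine hull
`P` of the points of `K v` that are reachable by exponentials.

*The affine hull `P` contains the orbit.* The Lie algebra maps `P` into its direction `D`, so modulo
`D` the representation on the span of `P` solves a homogeneous linear differential equation with
trivial initial value. It is therefore constant near the identity, and on all of `G` by
connectedness (`sub_mem_of_lieAlgebraAction_mem`). No surjectivity of an exponential map of `G` is
involved.
-/

namespace Bohr

open Filter Topology

/-! ### Means of polynomial phases -/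

section PolynomialPhase

open Polynomial

/-- A function whose derivative tends to zero grows sublinearly. -/
lemma tendsto_inv_smul_of_deriv_tendsto_zero {J j : ℝ → ℂ}
    (hJ : ∀ᶠ t in atTop, HasDerivAt J (j t) t) (hj : Tendsto j atTop (𝓝 0)) :
    Tendsto (fun T : ℝ => T⁻¹ • J T) atTop (𝓝 0) := by
  rw [Metric.tendsto_atTop]
  intro ε hε
  have h1 : ∀ᶠ t in atTop, ‖j t‖ ≤ ε / 2 := by
    filter_upwards [(Metric.tendsto_nhds.1 hj) (ε / 2) (half_pos hε)] with t ht
    simpa using ht.le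
  obtain ⟨T₀, hT₀⟩ := eventually_atTop.1 (hJ.and h1)
  set T₁ := max T₀ 0
  have hT₁0 : 0 ≤ T₁ := le_max_right _ _
  have h2 : Tendsto (fun T : ℝ => T⁻¹ * ‖J T₁‖) atTop (𝓝 0) := by
    simpa using tendsto_inv_atTop_zero.mul_const ‖J T₁‖
  obtain ⟨T₂, hT₂⟩ := Metric.tendsto_atTop.1 h2 (ε / 2) (half_pos hε)
  refine ⟨max 1 (max T₁ T₂), fun T hT => ?_⟩
  have hT0 : 1 ≤ T := (le_max_left _ _).trans hT
  have hTa : T₁ ≤ T := ((le_max_left _ _).trans (le_max_right _ _)).trans hT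
  have hTb : T₂ ≤ T := ((le_max_right _ _).trans (le_max_right _ _)).trans hT
  have hpos : 0 < T := by linarith
  have hmem : ∀ x ∈ Set.Ici T₁, T₀ ≤ x := fun x hx => (le_max_left _ _).trans hx
  have key := (convex_Ici T₁).norm_image_sub_le_of_norm_hasDerivWithin_le (f := J) (f' := j)
    (C := ε / 2) (fun x hx => (hT₀ x (hmem x hx)).1.hasDerivWithinAt)
    (fun x hx => (hT₀ x (hmem x hx)).2) Set.self_mem_Ici hTa
  have h3 := hT₂ T hTb
  rw [Real.norm_of_nonneg (by linarith)] at key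
  rw [Real.dist_eq, sub_zero, abs_of_nonneg (by positivity)] at h3
  have h4 : ‖J T‖ ≤ ‖J T₁‖ + ε / 2 * T := by
    have := norm_le_norm_add_norm_sub' (J T) (J T₁)
    nlinarith
  rw [dist_zero_right, norm_smul, norm_inv, Real.norm_of_nonneg hpos.le]
  calc T⁻¹ * ‖J T‖ ≤ T⁻¹ * (‖J T₁‖ + ε / 2 * T) := by gcongr
    _ = T⁻¹ * ‖J T₁‖ + ε / 2 := by field_simp
    _ < ε := by linarith

/-- The function `t ↦ exp (i q(t))` attached to a real polynomial phase `q`. -/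
noncomputable def phase (q : ℝ[X]) (t : ℝ) : ℂ := Complex.exp ((q.eval t : ℝ) * Complex.I)

lemma norm_phase (q : ℝ[X]) (t : ℝ) : ‖phase q t‖ = 1 := Complex.norm_exp_ofReal_mul_I _

lemma continuous_phase (q : ℝ[X]) : Continuous (phase q) := by
  unfold phase; fun_prop

lemma phase_zero (t : ℝ) : phase 0 t = 1 := by simp [phase]

lemma phase_add (p q : ℝ[X]) (t : ℝ) : phase (p + q) t = phase p t * phase q t := by
  simp [phase, add_mul, Complex.exp_add]

lemma phase_nsmul (n : ℕ) (q : ℝ[X]) (t : ℝ) : phase (n • q) t = phase q t ^ n := by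
  induction n with
  | zero => simp [phase_zero]
  | succ n ih => rw [succ_nsmul, phase_add, ih, pow_succ]

lemma phase_sum {ι : Type*} (s : Finset ι) (q : ι → ℝ[X]) (t : ℝ) :
    phase (∑ i ∈ s, q i) t = ∏ i ∈ s, phase (q i) t := by
  classical
  induction s using Finset.induction_on with
  | empty => simp [phase_zero]
  | insert a s ha ih => rw [Finset.sum_insert ha, phase_add, ih, Finset.prod_insert ha]

lemma phase_sub (p q : ℝ[X]) (t : ℝ) :
    phase (p - q) t = phase p t * starRingEnd ℂ (phase q t) := by
  simp only [phase, ← Complex.exp_conj, ← Complex.exp_add]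
  congr 1
  simp
  ring

lemma hasDerivAt_phase (q : ℝ[X]) (t : ℝ) :
    HasDerivAt (phase q) (phase q t * ((q.derivative.eval t : ℝ) * Complex.I)) t := by
  have h := ((q.hasDerivAt t).ofReal_comp.mul_const Complex.I).cexp
  exact h

/-- Away from the zeros of `q'`, an antiderivative of `phase q` is `phase q / (i q')` up to a term
with derivative `phase q * q'' / (i q' ^ 2)`; both are negligible on average. -/
lemma tendsto_mean_phase {q : ℝ[X]} (hq : q.derivative ≠ 0) :
    Tendsto (fun T : ℝ => T⁻¹ • ∫ t in (0 : ℝ)..T, phase q t) atTop (𝓝 0) := by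
  set d := q.derivative with hd
  have hne : ∀ᶠ t in atTop, d.eval t ≠ 0 := eventually_atTop_not_isRoot d hq
  let Φ : ℝ → ℂ := fun t => phase q t * ((d.eval t : ℝ) * Complex.I)⁻¹
  have hΦ : ∀ t, d.eval t ≠ 0 → HasDerivAt Φ
      (phase q t - phase q t * (((d.derivative.eval t / (d ^ 2).eval t : ℝ) : ℂ) *
        Complex.I⁻¹)) t := by
    intro t ht
    have htc : ((d.eval t : ℝ) : ℂ) ≠ 0 := by exact_mod_cast ht
    have h1 : HasDerivAt (fun t => ((d.eval t : ℝ) : ℂ) * Complex.I)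
        (((d.derivative.eval t : ℝ) : ℂ) * Complex.I) t :=
      (d.hasDerivAt t).ofReal_comp.mul_const Complex.I
    have h2 := (hasDerivAt_phase q t).mul (h1.inv (mul_ne_zero htc Complex.I_ne_zero))
    refine h2.congr_deriv ?_
    simp only [Pi.inv_apply, ← hd, eval_pow]
    push_cast
    have hI := Complex.I_ne_zero
    field_simp
    ring
  have hJ : ∀ᶠ t in atTop, HasDerivAt (fun T => (∫ t in (0 : ℝ)..T, phase q t) - Φ T)
      (phase q t * (((d.derivative.eval t / (d ^ 2).eval t : ℝ) : ℂ) * Complex.I⁻¹)) t := by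
    filter_upwards [hne] with t ht
    have h1 := intervalIntegral.integral_hasDerivAt_right
      ((continuous_phase q).intervalIntegrable 0 t)
      (continuous_phase q).stronglyMeasurable.stronglyMeasurableAtFilter
      (continuous_phase q).continuousAt
    exact (h1.sub (hΦ t ht)).congr_deriv (sub_sub_cancel _ _)
  have hj : Tendsto (fun t => phase q t *
      (((d.derivative.eval t / (d ^ 2).eval t : ℝ) : ℂ) * Complex.I⁻¹)) atTop (𝓝 0) := by
    rw [tendsto_zero_iff_norm_tendsto_zero]
    simp only [norm_mul, norm_phase, one_mul, norm_inv, Complex.norm_I, inv_one, mul_one,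
      Complex.norm_real]
    rw [← tendsto_zero_iff_norm_tendsto_zero]
    refine div_tendsto_atTop_zero_of_degree_lt _ _ ?_
    calc d.derivative.degree < d.degree := degree_derivative_lt hq
      _ ≤ (d ^ 2).degree := by
        rw [pow_two]
        exact degree_le_mul_left d hq
  have hΦ0 : Tendsto (fun T : ℝ => T⁻¹ • Φ T) atTop (𝓝 0) := by
    rw [tendsto_zero_iff_norm_tendsto_zero]
    have h1 : Tendsto (fun t => (1 : ℝ[X]).eval t / (X * d).eval t) atTop (𝓝 0) := by
      refine div_tendsto_atTop_zero_of_degree_lt _ _ ?_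
      rw [degree_mul, degree_X, degree_one, degree_eq_natDegree hq]
      exact_mod_cast (show 0 < 1 + d.natDegree by omega)
    have h2 := h1.norm
    rw [norm_zero] at h2
    refine h2.congr fun t => ?_
    simp [Φ, norm_phase, mul_comm]
  have := (tendsto_inv_smul_of_deriv_tendsto_zero hJ hj).add hΦ0
  rw [add_zero] at this
  refine this.congr fun T => ?_
  rw [← smul_add, sub_add_cancel]

end PolynomialPhase

/-! ### Simultaneous approximation by polynomial phases -/

section Kronecker

open Polynomial

lemma tendsto_mean_phase_ite {q : ℝ[X]} (hq : derivative q = 0 → q = 0) [Decidable (q = 0)] :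
    Tendsto (fun T : ℝ => T⁻¹ • ∫ t in (0 : ℝ)..T, phase q t) atTop
      (𝓝 (if q = 0 then 1 else 0)) := by
  split_ifs with h
  · subst h
    refine (tendsto_congr' ?_).2 tendsto_const_nhds
    filter_upwards [eventually_gt_atTop 0] with T hT
    simp [phase_zero, hT.ne']
  · exact tendsto_mean_phase (mt hq h)

/-- A lower bound for the supremum of a trigonometric polynomial with nonnegative coefficients and
polynomial phases: the mean of its squared modulus is at least the sum of the squares of its
coefficients, since cross terms have mean `0` or `1`. -/
lemma sum_sq_le_of_norm_sq_le {α : Type*} (s : Finset α) (b : α → ℝ) (hb : ∀ p, 0 ≤ b p)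
    (Q : α → ℝ[X])
    (hQ : ∀ p ∈ s, ∀ p' ∈ s, derivative (Q p - Q p') = 0 → Q p - Q p' = 0) {M : ℝ}
    (hM : ∀ t, ‖∑ p ∈ s, (b p : ℂ) * phase (Q p) t‖ ^ 2 ≤ M) :
    ∑ p ∈ s, b p ^ 2 ≤ M := by
  classical
  have hexp : ∀ t, ((‖∑ p ∈ s, (b p : ℂ) * phase (Q p) t‖ ^ 2 : ℝ) : ℂ) =
      ∑ p ∈ s, ∑ p' ∈ s, ((b p * b p' : ℝ) : ℂ) * phase (Q p - Q p') t := by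
    intro t
    push_cast
    rw [← Complex.mul_conj', map_sum, Finset.sum_mul_sum]
    refine Finset.sum_congr rfl fun p _ => Finset.sum_congr rfl fun p' _ => ?_
    rw [phase_sub, map_mul, Complex.conj_ofReal]
    ring
  have hcont : Continuous fun t => ‖∑ p ∈ s, (b p : ℂ) * phase (Q p) t‖ ^ 2 := by
    have := fun p => continuous_phase (Q p)
    fun_prop
  have hlim : Tendsto (fun T : ℝ => T⁻¹ • ∫ t in (0 : ℝ)..T,
      ((‖∑ p ∈ s, (b p : ℂ) * phase (Q p) t‖ ^ 2 : ℝ) : ℂ)) atTop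
      (𝓝 (∑ p ∈ s, ∑ p' ∈ s, ((b p * b p' : ℝ) : ℂ) *
        (if Q p - Q p' = 0 then 1 else 0))) := by
    have h1 := tendsto_finsetSum s fun p hp => tendsto_finsetSum s fun p' hp' =>
      (tendsto_mean_phase_ite (hQ p hp p' hp')).const_mul ((b p * b p' : ℝ) : ℂ)
    refine h1.congr fun T => ?_
    simp only [hexp]
    rw [intervalIntegral.integral_finsetSum, Finset.smul_sum]
    · refine Finset.sum_congr rfl fun p _ => ?_
      rw [intervalIntegral.integral_finsetSum, Finset.smul_sum]
      · refine Finset.sum_congr rfl fun p' _ => ?_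
        rw [intervalIntegral.integral_const_mul, mul_smul_comm]
      · exact fun p' _ => (continuous_const.mul (continuous_phase _)).intervalIntegrable _ _
    · exact fun p _ => (continuous_finsetSum _ fun p' _ =>
        continuous_const.mul (continuous_phase _)).intervalIntegrable _ _
  have hre := (Complex.continuous_re.tendsto _).comp hlim
  have hle : (∑ p ∈ s, ∑ p' ∈ s, ((b p * b p' : ℝ) : ℂ) *
        (if Q p - Q p' = 0 then 1 else 0)).re ≤ M := by
    refine le_of_tendsto hre ?_
    filter_upwards [eventually_gt_atTop 0] with T hT
    rw [Function.comp_apply, intervalIntegral.integral_ofReal, Complex.real_smul,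
      ← Complex.ofReal_mul, Complex.ofReal_re, inv_mul_le_iff₀ hT]
    have := intervalIntegral.integral_mono_on (μ := MeasureTheory.volume) hT.le
      (hcont.intervalIntegrable 0 T) (intervalIntegrable_const (c := M)) fun t _ => hM t
    simpa using this
  refine le_trans ?_ hle
  rw [Complex.re_sum]
  refine Finset.sum_le_sum fun p hp => ?_
  have hnn : ∀ p' ∈ s, 0 ≤ (((b p * b p' : ℝ) : ℂ) *
      (if Q p - Q p' = 0 then 1 else 0)).re := by
    intro p' _
    split_ifs
    · simpa using mul_nonneg (hb p) (hb p')
    · simp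
  rw [Complex.re_sum]
  refine le_trans ?_ (Finset.single_le_sum hnn hp)
  simp [pow_two]

/-- **Kronecker's theorem for polynomial phases.** If no integral combination of the real
polynomials `q j` is a nonzero constant, then the numbers `exp (i q_j(t))` are simultaneously close
to `1` for some `t`. Otherwise `∏ (1 + exp (i q_j)) ^ N` would be uniformly smaller than its value
`2 ^ (N k)` at `1` by an exponential factor, whereas the squares of its coefficients are smaller
only by a factor polynomial in `N`. -/
theorem exists_norm_phase_sub_one_lt {ι : Type*} [Fintype ι] (q : ι → ℝ[X])
    (hq : ∀ n : ι → ℤ, derivative (∑ j, n j • q j) = 0 → ∑ j, n j • q j = 0)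
    {ε : ℝ} (hε : 0 < ε) : ∃ t, ∀ j, ‖phase (q j) t - 1‖ < ε := by
  classical
  by_contra! hcon
  set k := Fintype.card ι
  set r : ℝ := 1 - ε ^ 2 / 4 with hr
  have hpar : ∀ z : ℂ, ‖z‖ = 1 → ‖1 + z‖ ^ 2 = 4 - ‖z - 1‖ ^ 2 := by
    intro z hz
    have h := parallelogram_law_with_norm ℝ z 1
    rw [hz, norm_one, add_comm z 1] at h
    nlinarith
  have hle2 : ∀ z : ℂ, ‖z‖ = 1 → ‖1 + z‖ ^ 2 ≤ 4 := fun z hz => by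
    rw [hpar z hz]; nlinarith [sq_nonneg ‖z - 1‖]
  have hbad : ∀ t, ∃ j, ‖1 + phase (q j) t‖ ^ 2 ≤ 4 * r := by
    intro t
    obtain ⟨j, hj⟩ := hcon t
    refine ⟨j, ?_⟩
    rw [hpar _ (norm_phase _ _), hr]
    nlinarith
  have hr0 : 0 ≤ r := by
    obtain ⟨j, hj⟩ := hbad 0
    nlinarith [sq_nonneg ‖1 + phase (q j) 0‖]
  have hr1 : r < 1 := by rw [hr]; nlinarith [sq_pos_of_pos hε]
  have hupper : ∀ t, ∏ j, ‖1 + phase (q j) t‖ ^ 2 ≤ 4 ^ k * r := by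
    intro t
    obtain ⟨j, hj⟩ := hbad t
    rw [← Finset.mul_prod_erase _ _ (Finset.mem_univ j)]
    have h1 : ∏ i ∈ Finset.univ.erase j, ‖1 + phase (q i) t‖ ^ 2 ≤ 4 ^ (k - 1) := by
      refine (Finset.prod_le_prod (fun _ _ => by positivity)
        fun i _ => hle2 _ (norm_phase (q i) t)).trans_eq ?_
      rw [Finset.prod_const, Finset.card_erase_of_mem (Finset.mem_univ j), Finset.card_univ]
    have hk : k = k - 1 + 1 := (Nat.sub_add_cancel (Fintype.card_pos_iff.2 ⟨j⟩)).symm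
    calc _ ≤ (4 * r) * 4 ^ (k - 1) := by gcongr
      _ = 4 ^ k * r := by rw [hk, pow_succ, Nat.add_sub_cancel]; ring
  have hN : ∀ N : ℕ, 1 ≤ ((N + 1 : ℕ) : ℝ) ^ k * r ^ N := by
    intro N
    let S : Finset (ι → ℕ) := Fintype.piFinset fun _ => Finset.range (N + 1)
    let b : (ι → ℕ) → ℝ := fun p => ∏ j, (N.choose (p j) : ℝ)
    have hB : ∀ t, ∏ j, (1 + phase (q j) t) ^ N =
        ∑ p ∈ S, (b p : ℂ) * phase (∑ j, p j • q j) t := by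
      intro t
      simp only [add_comm (1 : ℂ), add_pow, one_pow, mul_one]
      rw [Finset.prod_univ_sum]
      refine Finset.sum_congr rfl fun p _ => ?_
      rw [phase_sum, Finset.prod_mul_distrib, mul_comm]
      simp only [b, phase_nsmul, Complex.ofReal_prod, Complex.ofReal_natCast]
    have hsq : ∑ p ∈ S, b p ^ 2 ≤ (4 ^ k * r) ^ N := by
      refine sum_sq_le_of_norm_sq_le S b (fun p => by positivity) (fun p => ∑ j, p j • q j)
        (fun p _ p' _ => ?_) fun t => ?_
      · have : ∑ j, p j • q j - ∑ j, p' j • q j = ∑ j, ((p j : ℤ) - (p' j : ℤ)) • q j := by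
          rw [← Finset.sum_sub_distrib]
          refine Finset.sum_congr rfl fun j _ => ?_
          rw [sub_smul, natCast_zsmul, natCast_zsmul]
        rw [this]
        exact hq _
      · rw [← hB, norm_prod]
        simp only [norm_pow]
        rw [Finset.prod_pow, ← pow_mul, mul_comm, pow_mul, ← Finset.prod_pow]
        exact pow_le_pow_left₀ (by positivity) (hupper t) N
    have hsum : ∑ p ∈ S, b p = (2 ^ N) ^ k := by
      simp only [S, b]
      rw [← Finset.prod_univ_sum (fun _ => Finset.range (N + 1))
        (fun (_ : ι) n => (N.choose n : ℝ)), Finset.prod_const, Finset.card_univ]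
      congr 1
      exact_mod_cast Nat.sum_range_choose N
    have hcard : (S.card : ℝ) = ((N + 1 : ℕ) : ℝ) ^ k := by
      simp [S, k]
    have hcs := sq_sum_le_card_mul_sum_sq (s := S) (f := b)
    rw [hsum, hcard] at hcs
    have h4 : ((2 : ℝ) ^ N) ^ k * ((2 : ℝ) ^ N) ^ k = (4 ^ k) ^ N := by
      rw [← mul_pow, ← mul_pow, ← pow_mul, ← pow_mul, mul_comm N k]; norm_num
    have h5 : (4 ^ k : ℝ) ^ N * 1 ≤ (4 ^ k : ℝ) ^ N * (((N + 1 : ℕ) : ℝ) ^ k * r ^ N) := by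
      calc (4 ^ k : ℝ) ^ N * 1 = ((2 ^ N) ^ k) ^ 2 := by rw [mul_one, ← h4, pow_two]
        _ ≤ _ := hcs
        _ ≤ ((N + 1 : ℕ) : ℝ) ^ k * (4 ^ k * r) ^ N := by gcongr
        _ = _ := by rw [mul_pow]; ring
    exact le_of_mul_le_mul_left h5 (by positivity)
  have hlim : Tendsto (fun N : ℕ => ((N + 1 : ℕ) : ℝ) ^ k * r ^ N) atTop (𝓝 0) := by
    have h1 := (tendsto_pow_const_mul_const_pow_of_abs_lt_one k
      (abs_lt.2 ⟨by linarith, hr1⟩)).const_mul ((2 : ℝ) ^ k)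
    rw [mul_zero] at h1
    refine tendsto_of_tendsto_of_tendsto_of_le_of_le' tendsto_const_nhds h1
      (Eventually.of_forall fun N => by positivity) ?_
    filter_upwards [eventually_ge_atTop 1] with N hN
    have h2 : ((N + 1 : ℕ) : ℝ) ≤ 2 * N := by
      have : (1 : ℝ) ≤ N := by exact_mod_cast hN
      push_cast; linarith
    rw [← mul_assoc, ← mul_pow]
    gcongr
  exact absurd (ge_of_tendsto' hlim hN) (by norm_num)

end Kronecker

/-! ### Characters, the Bohr topology and polynomial curves -/

section BohrTopology

open Polynomial

namespace DiscreteDual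

lemma eval_add {V : Type*} [AddCommGroup V] [TopologicalSpace V] (χ : DiscreteDual V) (x y : V) :
    χ.eval (x + y) = χ.eval x * χ.eval y :=
  map_mul (show PontryaginDual (Multiplicative V) from χ) _ _

lemma eval_zero {V : Type*} [AddCommGroup V] [TopologicalSpace V] (χ : DiscreteDual V) :
    χ.eval 0 = 1 :=
  map_one (show PontryaginDual (Multiplicative V) from χ)

lemma continuous_eval {V : Type*} [AddCommGroup V] [TopologicalSpace V] (χ : DiscreteDual V) :
    Continuous χ.eval :=
  (map_continuous (show PontryaginDual (Multiplicative V) from χ)).comp continuous_ofAdd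

/-- A continuous character of a real vector space lifts through the covering map `exp` to a
continuous linear functional; the lift is additive because lifts are unique. -/
lemma exists_eval_eq_exp {V : Type*} [NormedAddCommGroup V] [NormedSpace ℝ V]
    (χ : DiscreteDual V) :
    ∃ l : V →L[ℝ] ℝ, ∀ x, (χ.eval x : ℂ) = Complex.exp ((l x : ℝ) * Complex.I) := by
  let f : C(V, ℂ) := ⟨fun x => (χ.eval x : ℂ), by have := χ.continuous_eval; fun_prop⟩
  obtain ⟨L, ⟨hL0, hL⟩, huniq⟩ := Complex.isCoveringMapOn_exp.existsUnique_continuousMap_lifts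
    f (a₀ := 0) (e₀ := 0) (by simp [f, eval_zero]) (fun x => by simp [f])
  have hLx : ∀ x, Complex.exp (L x) = χ.eval x := fun x => congrFun hL x
  have hadd : ∀ x y, L (x + y) = L x + L y := by
    intro x y
    have h := huniq ⟨fun x => L (x + y) - L y, by fun_prop⟩ ⟨by simp, funext fun x => by
      simp [f, Complex.exp_sub, hLx, eval_add]⟩
    have h2 := DFunLike.congr_fun h x
    simp only [ContinuousMap.coe_mk] at h2
    rw [← h2, sub_add_cancel]
  have hre : ∀ x, (L x).re = 0 := by
    intro x
    have h := Complex.norm_exp (L x)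
    rw [hLx, Circle.norm_coe] at h
    simpa using h.symm
  let l : V →+ ℝ := AddMonoidHom.mk' (fun x => (L x).im) fun x y => by simp [hadd]
  refine ⟨l.toRealLinearMap (Complex.continuous_im.comp L.continuous), fun x => ?_⟩
  rw [← hLx]
  congr 1
  apply Complex.ext
  · simp [hre]
  · rw [Complex.im_ofReal_mul, Complex.I_im, mul_one]
    rfl

end DiscreteDual

lemma bohrTopology_eq_induced (V : Type*) [AddCommGroup V] [TopologicalSpace V] :
    bohrTopology V = TopologicalSpace.induced (fun v (χ : DiscreteDual V) => χ.eval v)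
      Pi.topologicalSpace := by
  have h1 : IsInducing (fun φ : DiscreteDual V →ₜ* Circle => (φ : DiscreteDual V → Circle)) :=
    (ContinuousMap.isHomeomorph_coe.isInducing).comp
      (ContinuousMonoidHom.isInducing_toContinuousMap _ _)
  calc bohrTopology V = TopologicalSpace.induced (toCompactification V)
        (TopologicalSpace.induced
          (fun φ : DiscreteDual V →ₜ* Circle => (φ : DiscreteDual V → Circle))
          Pi.topologicalSpace) := congrArg _ h1.eq_induced
    _ = _ := induced_compose

lemma le_bohrTopology (V : Type*) [AddCommGroup V] [t : TopologicalSpace V] :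
    t ≤ bohrTopology V := by
  rw [bohrTopology_eq_induced]
  exact continuous_iff_le_induced.1 (continuous_pi fun χ => χ.continuous_eval)

/-- A vector lies in the Bohr closure of a set if finitely many characters at a time can be
approximated on the set. -/
lemma mem_bohr_closure {V : Type*} [AddCommGroup V] [TopologicalSpace V] {S : Set V} {w : V}
    (h : ∀ (F : Finset (DiscreteDual V)) (ε : ℝ), 0 < ε →
      ∃ s ∈ S, ∀ χ ∈ F, ‖(χ.eval s : ℂ) - χ.eval w‖ < ε) :
    w ∈ @closure V (bohrTopology V) S := by
  rw [bohrTopology_eq_induced, closure_induced, mem_closure_iff_nhds_basis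
    (by rw [nhds_pi]; exact Filter.hasBasis_pi fun χ => Metric.nhds_basis_ball)]
  rintro ⟨I, r⟩ ⟨hI, hr⟩
  obtain ⟨ε, hε, hεr⟩ : ∃ ε > 0, ∀ χ ∈ I, ε ≤ r χ := by
    induction I, hI using Set.Finite.induction_on with
    | empty => exact ⟨1, one_pos, by simp⟩
    | @insert a s _ _ ih =>
      obtain ⟨ε, hε, h1⟩ := ih fun i hi => hr i (Set.mem_insert_of_mem _ hi)
      refine ⟨min ε (r a), lt_min hε (hr a (Set.mem_insert _ _)), ?_⟩
      rintro χ (rfl | hχ)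
      · exact min_le_right _ _
      · exact (min_le_left _ _).trans (h1 χ hχ)
  obtain ⟨s, hs, hsF⟩ := h hI.toFinset ε hε
  refine ⟨_, ⟨s, hs, rfl⟩, fun χ hχ => ?_⟩
  exact ((dist_eq_norm (χ.eval s : ℂ) _).trans_lt (hsF χ (hI.mem_toFinset.2 hχ))).trans_le
    (hεr χ hχ)

section PolynomialCurve

variable {V : Type*} [NormedAddCommGroup V] [NormedSpace ℝ V]

/-- A curve in a real vector space is polynomial if every continuous linear functional restricts
to a real polynomial on it. -/
def IsPolynomialCurve (u : ℝ → V) : Prop :=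
  ∀ l : V →L[ℝ] ℝ, ∃ q : ℝ[X], ∀ t, l (u t) = q.eval t

lemma isPolynomialCurve_const (v : V) : IsPolynomialCurve fun _ => v :=
  fun l => ⟨C (l v), fun t => by simp⟩

lemma IsPolynomialCurve.sum {α : Type*} (s : Finset α) {u : α → ℝ → V}
    (hu : ∀ a ∈ s, IsPolynomialCurve (u a)) : IsPolynomialCurve fun t => ∑ a ∈ s, u a t := by
  intro l
  choose! q hq using fun a ha => hu a ha l
  refine ⟨∑ a ∈ s, q a, fun t => ?_⟩
  rw [map_sum, eval_finsetSum]
  exact Finset.sum_congr rfl fun a ha => hq a ha t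

lemma IsPolynomialCurve.eval_smul (p : ℝ[X]) {u : ℝ → V} (hu : IsPolynomialCurve u) :
    IsPolynomialCurve fun t => p.eval t • u t := by
  intro l
  obtain ⟨q, hq⟩ := hu l
  exact ⟨p * q, fun t => by simp [hq]⟩

lemma IsPolynomialCurve.map (A : V →L[ℝ] V) {u : ℝ → V} (hu : IsPolynomialCurve u) :
    IsPolynomialCurve fun t => A (u t) :=
  fun l => hu (l.comp A)

/-- A polynomial curve is Bohr dense in its affine hull. -/
theorem IsPolynomialCurve.affineSpan_subset_bohr_closure {u : ℝ → V} (hu : IsPolynomialCurve u) :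
    (affineSpan ℝ (Set.range u) : Set V) ⊆ @closure V (bohrTopology V) (Set.range u) := by
  intro w hw
  refine mem_bohr_closure fun F ε hε => ?_
  choose l hl using fun χ : F => χ.1.exists_eval_eq_exp
  choose q hq using fun χ : F => hu (l χ)
  -- Adjusted by the value at `w`, no combination of the phases is a nonzero constant: a functional
  -- constant on the curve takes the same value at `w`.
  obtain ⟨t, ht⟩ := exists_norm_phase_sub_one_lt (fun χ : F => q χ - C (l χ w)) (fun n hn => by
    obtain ⟨c, hc⟩ := natDegree_eq_zero.1 (derivative_eq_zero.1 hn)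
    rw [← hc]
    let Λ : V →ₗ[ℝ] ℝ := ∑ χ, n χ • (l χ : V →ₗ[ℝ] ℝ)
    have hΛ : ∀ t, Λ (u t) - Λ w = c := by
      intro t
      have h1 := congrArg (eval t) hc
      rw [eval_C, eval_finsetSum] at h1
      rw [h1, ← map_sub, LinearMap.sum_apply]
      refine Finset.sum_congr rfl fun χ _ => ?_
      simp [← hq]
    have hsub : affineSpan ℝ (Set.range u) ≤
        AffineSubspace.comap Λ.toAffineMap (affineSpan ℝ {c + Λ w}) := by
      rw [affineSpan_le]
      rintro _ ⟨t, rfl⟩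
      simp [← hΛ t]
    have h2 := hsub hw
    simp at h2
    simp [h2]) hε
  refine ⟨u t, ⟨t, rfl⟩, fun χ hχ => ?_⟩
  have h3 := ht ⟨χ, hχ⟩
  have h4 : (χ.eval (u t) : ℂ) - χ.eval w =
      (phase (q ⟨χ, hχ⟩ - C (l ⟨χ, hχ⟩ w)) t - 1) * χ.eval w := by
    rw [hl ⟨χ, hχ⟩ (u t), hl ⟨χ, hχ⟩ w, sub_mul, one_mul, phase, ← Complex.exp_add, hq]
    congr 2
    simp
    ring
  rw [h4, norm_mul, Circle.norm_coe, mul_one]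
  exact h3

end PolynomialCurve

end BohrTopology

/-! ### Polynomial families of operators -/

section PolynomialFamily

open Polynomial

lemma norm_pow_sub_pow_le {𝔸 : Type*} [NormedRing 𝔸] {a b : 𝔸} {M : ℝ} (hM : 1 ≤ M)
    (ha : ‖a‖ ≤ M) (hb : ‖b‖ ≤ M) (n : ℕ) : ‖a ^ n - b ^ n‖ ≤ n * M ^ n * ‖a - b‖ := by
  induction n with
  | zero => simp
  | succ n ih =>
    have h1 : a ^ (n + 1) - b ^ (n + 1) = a ^ n * (a - b) + (a ^ n - b ^ n) * b := by
      rw [pow_succ, pow_succ]; noncomm_ring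
    have h2 : ‖a ^ n * (a - b)‖ ≤ M ^ (n + 1) * ‖a - b‖ := by
      rcases n.eq_zero_or_pos with rfl | hn
      · simpa using le_mul_of_one_le_left (norm_nonneg (a - b)) hM
      · calc ‖a ^ n * (a - b)‖ ≤ ‖a ^ n‖ * ‖a - b‖ := norm_mul_le _ _
          _ ≤ ‖a‖ ^ n * ‖a - b‖ := by gcongr; exact norm_pow_le' a hn
          _ ≤ M ^ n * ‖a - b‖ := by gcongr
          _ ≤ M ^ (n + 1) * ‖a - b‖ := by gcongr; exact n.le_succ
    have h3 : ‖(a ^ n - b ^ n) * b‖ ≤ n * M ^ (n + 1) * ‖a - b‖ := by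
      calc ‖(a ^ n - b ^ n) * b‖ ≤ ‖a ^ n - b ^ n‖ * ‖b‖ := norm_mul_le _ _
        _ ≤ (n * M ^ n * ‖a - b‖) * M := by gcongr
        _ = n * M ^ (n + 1) * ‖a - b‖ := by ring
    rw [h1]
    refine (norm_add_le _ _).trans ((add_le_add h2 h3).trans_eq ?_)
    push_cast; ring

variable {V : Type*} [NormedAddCommGroup V] [NormedSpace ℝ V]

lemma eventually_norm_le_of_hasDerivAt {f : ℝ → V →L[ℝ] V} {A : V →L[ℝ] V} (h0 : f 0 = 1)
    (hf : HasDerivAt f A 0) : ∃ C > 0, ∀ᶠ s in 𝓝 0, ‖f s‖ ≤ 1 + C * |s| := by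
  obtain ⟨C, hC, h⟩ := (hf.isBigO_sub).exists_pos
  refine ⟨C, hC, ?_⟩
  filter_upwards [h.bound] with s hs
  rw [h0, sub_zero, Real.norm_eq_abs] at hs
  have h1 : ‖(1 : V →L[ℝ] V)‖ ≤ 1 := ContinuousLinearMap.norm_id_le
  linarith [norm_le_norm_add_norm_sub' (f s) 1]

/-- The product formula for the exponential: a curve through `1` with velocity `A` recovers
`exp A`. -/
lemma tendsto_pow_exp [CompleteSpace V] {f : ℝ → V →L[ℝ] V} {A : V →L[ℝ] V} (h0 : f 0 = 1)
    (hf : HasDerivAt f A 0) :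
    Tendsto (fun n : ℕ => f (n : ℝ)⁻¹ ^ n) atTop (𝓝 (NormedSpace.exp A)) := by
  let g : ℝ → V →L[ℝ] V := fun s => NormedSpace.exp (s • A)
  have hg0 : g 0 = 1 := by simp [g]
  have hg : HasDerivAt g A 0 := by simpa using hasDerivAt_exp_smul_const (𝕂 := ℝ) A 0
  have hgn : ∀ᶠ n : ℕ in atTop, g (n : ℝ)⁻¹ ^ n = NormedSpace.exp A := by
    filter_upwards [eventually_gt_atTop 0] with n hn
    let _ : NormedAlgebra ℚ (V →L[ℝ] V) := NormedAlgebra.restrictScalars ℚ ℝ _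
    rw [← NormedSpace.exp_nsmul, ← Nat.cast_smul_eq_nsmul ℝ, smul_smul,
      mul_inv_cancel₀ (by positivity), one_smul]
  obtain ⟨C₁, hC₁, h₁⟩ := eventually_norm_le_of_hasDerivAt h0 hf
  obtain ⟨C₂, hC₂, h₂⟩ := eventually_norm_le_of_hasDerivAt hg0 hg
  have hinv : Tendsto (fun n : ℕ => (n : ℝ)⁻¹) atTop (𝓝 0) := tendsto_inv_atTop_nhds_zero_nat
  set C := max C₁ C₂
  have hC : 0 < C := lt_max_of_lt_left hC₁
  have hlittle : (fun s => f s - g s) =o[𝓝 0] fun s => s := by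
    have := (hasDerivAt_iff_isLittleO.1 (hf.sub hg))
    simpa [h0, hg0] using this
  have hsmall : Tendsto (fun n : ℕ => (n : ℝ) * ‖f (n : ℝ)⁻¹ - g (n : ℝ)⁻¹‖) atTop (𝓝 0) := by
    have h1 := ((hlittle.comp_tendsto hinv).norm_left.norm_right).tendsto_div_nhds_zero
    refine h1.congr fun n => ?_
    simp [div_inv_eq_mul, mul_comm]
  rw [tendsto_iff_norm_sub_tendsto_zero]
  refine squeeze_zero' (Eventually.of_forall fun _ => norm_nonneg _) ?_
    (by simpa using hsmall.const_mul (Real.exp C))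
  filter_upwards [hgn, hinv.eventually h₁, hinv.eventually h₂, eventually_gt_atTop 0]
    with n hn hn₁ hn₂ hpos
  have hn0 : (0 : ℝ) < n := by exact_mod_cast hpos
  rw [abs_of_pos (by positivity)] at hn₁ hn₂
  have hM : (1 + C * (n : ℝ)⁻¹) ^ n ≤ Real.exp C := by
    calc (1 + C * (n : ℝ)⁻¹) ^ n ≤ Real.exp (C * (n : ℝ)⁻¹) ^ n := by
          gcongr; linarith [Real.add_one_le_exp (C * (n : ℝ)⁻¹)]
      _ = Real.exp C := by rw [← Real.exp_nat_mul]; congr 1; field_simp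
  rw [← hn]
  refine (norm_pow_sub_pow_le (M := 1 + C * (n : ℝ)⁻¹) (le_add_of_nonneg_right (by positivity))
    (hn₁.trans ?_) (hn₂.trans ?_) n).trans ?_
  · gcongr; exact le_max_left _ _
  · gcongr; exact le_max_right _ _
  · calc _ = (1 + C * (n : ℝ)⁻¹) ^ n * (n * ‖f (n : ℝ)⁻¹ - g (n : ℝ)⁻¹‖) := by ring
      _ ≤ _ := by gcongr

lemma exp_eq_sum_of_pow_eq_zero {A : V →L[ℝ] V} {k : ℕ} (hA : A ^ k = 0) :
    NormedSpace.exp A = ∑ i ∈ Finset.range k, (i.factorial : ℝ)⁻¹ • A ^ i := by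
  rw [NormedSpace.exp_eq_tsum ℝ]
  refine tsum_eq_sum fun i hi => ?_
  rw [pow_eq_zero_of_le (by simpa using hi) hA, smul_zero]

/-- Families of operators in the monoid `K` parametrized by the real line that carry polynomial
curves to polynomial curves. -/
def polynomialFamilies (K : Submonoid (V →L[ℝ] V)) : Submonoid (ℝ → V →L[ℝ] V) where
  carrier := {C | (∀ t, C t ∈ K) ∧
    ∀ u : ℝ → V, IsPolynomialCurve u → IsPolynomialCurve fun t => C t (u t)}
  one_mem' := ⟨fun _ => K.one_mem, fun _ hu => hu⟩
  mul_mem' ha hb := ⟨fun t => K.mul_mem (ha.1 t) (hb.1 t), fun u hu => ha.2 _ (hb.2 u hu)⟩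

/-- The operators that can be joined to `1` by a polynomial family in `K`. The parametrization of
the family can be prescribed: for every polynomial `p` there is a family that is `1` where `p`
vanishes and is the given operator where `p` equals `1`. -/
def polynomiallyReachable (K : Submonoid (V →L[ℝ] V)) : Submonoid (V →L[ℝ] V) where
  carrier := {h | ∀ p : ℝ[X], ∃ C ∈ polynomialFamilies K,
    ∀ t, (p.eval t = 0 → C t = 1) ∧ (p.eval t = 1 → C t = h)}
  one_mem' p := ⟨1, one_mem _, fun _ => ⟨fun _ => rfl, fun _ => rfl⟩⟩
  mul_mem' := by
    intro a b ha hb p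
    obtain ⟨C, hC, h1⟩ := ha p
    obtain ⟨D, hD, h2⟩ := hb p
    refine ⟨C * D, mul_mem hC hD, fun t => ⟨fun h => ?_, fun h => ?_⟩⟩
    · rw [Pi.mul_apply, (h1 t).1 h, (h2 t).1 h, one_mul]
    · rw [Pi.mul_apply, (h1 t).2 h, (h2 t).2 h]

lemma exp_mem_polynomiallyReachable {K : Submonoid (V →L[ℝ] V)} {A : V →L[ℝ] V}
    (hA : IsNilpotent A) (hK : ∀ s : ℝ, NormedSpace.exp (s • A) ∈ K) :
    NormedSpace.exp A ∈ polynomiallyReachable K := by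
  intro p
  refine ⟨fun t => NormedSpace.exp (p.eval t • A), ⟨fun t => hK _, fun u hu => ?_⟩,
    fun t => ⟨fun h => by simp [h], fun h => by simp [h]⟩⟩
  obtain ⟨k, hk⟩ := hA
  have h1 : (fun t => NormedSpace.exp (p.eval t • A) (u t)) = fun t =>
      ∑ i ∈ Finset.range k, (C (i.factorial : ℝ)⁻¹ * p ^ i).eval t • (A ^ i) (u t) := by
    funext t
    rw [exp_eq_sum_of_pow_eq_zero (k := k) (by rw [_root_.smul_pow, hk, smul_zero]),
      _root_.sum_apply]
    refine Finset.sum_congr rfl fun i _ => ?_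
    rw [_root_.smul_pow, smul_smul]
    simp
  rw [h1]
  exact IsPolynomialCurve.sum _ fun i _ => (hu.map (A ^ i)).eval_smul _

/-- By Lagrange interpolation a single polynomial family passes through any finitely many
polynomially reachable operators. -/
lemma exists_polynomialFamily_through {K : Submonoid (V →L[ℝ] V)} {ι : Type*} (s : Finset ι)
    (h : ι → polynomiallyReachable K) :
    ∃ C ∈ polynomialFamilies K, ∀ i ∈ s, ∃ t, C t = h i := by
  classical
  let ν : s → ℝ := fun i => (s.equivFin i : ℕ)
  have hν : Function.Injective ν := fun i j hij => by
    simpa [ν, Fin.val_inj] using hij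
  have key : ∀ T : Finset s, ∃ C ∈ polynomialFamilies K,
      ∀ i, (i ∈ T → C (ν i) = h i) ∧ (i ∉ T → C (ν i) = 1) := by
    intro T
    induction T using Finset.induction_on with
    | empty => exact ⟨1, one_mem _, fun i => by simp⟩
    | insert a T ha ih =>
      obtain ⟨C, hC, h1⟩ := ih
      obtain ⟨D, hD, h2⟩ := (h a).2 (Lagrange.basis Finset.univ ν a)
      have hDa : D (ν a) = h a :=
        (h2 _).2 (Lagrange.eval_basis_self hν.injOn (Finset.mem_univ a))
      have hDi : ∀ i, i ≠ a → D (ν i) = 1 := fun i hi =>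
        (h2 _).1 (Lagrange.eval_basis_of_ne hi.symm (Finset.mem_univ i))
      refine ⟨C * D, mul_mem hC hD, fun i => ?_⟩
      rw [Pi.mul_apply]
      rcases eq_or_ne i a with rfl | hi
      · simp [(h1 i).2 ha, hDa]
      · simp only [hDi i hi, mul_one, Finset.mem_insert, hi, false_or]
        exact h1 i
  obtain ⟨C, hC, h1⟩ := key Finset.univ
  exact ⟨C, hC, fun i hi => ⟨ν ⟨i, hi⟩, (h1 ⟨i, hi⟩).1 (Finset.mem_univ _)⟩⟩

/-- The part of an orbit reached by polynomial families has its affine hull in the Bohr closure of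
the orbit. -/
theorem affineSpan_reachable_subset_bohr_closure (K : Submonoid (V →L[ℝ] V)) (v : V) :
    (affineSpan ℝ (Set.range fun h : polynomiallyReachable K => h.1 v) : Set V) ⊆
      @closure V (bohrTopology V) (Set.range fun h : K => h.1 v) := by
  intro w hw
  obtain ⟨s, c, hc, rfl⟩ := eq_affineCombination_of_mem_affineSpan hw
  obtain ⟨C, hC, hs⟩ := exists_polynomialFamily_through s (fun h : polynomiallyReachable K => h)
  have h1 := affineCombination_mem_affineSpan_image (s' := (s : Set (polynomiallyReachable K))) hc
    (fun i hi hi' => absurd hi hi') (fun h => h.1 v)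
  have h2 : (fun h : polynomiallyReachable K => h.1 v) '' s ⊆ Set.range fun t => C t v := by
    rintro _ ⟨h, hh, rfl⟩
    obtain ⟨t, ht⟩ := hs h hh
    exact ⟨t, by simp [ht]⟩
  have h3 := (hC.2 _ (isPolynomialCurve_const v)).affineSpan_subset_bohr_closure
    (affineSpan_mono ℝ h2 h1)
  refine @closure_mono V (bohrTopology V) _ _ ?_ _ h3
  rintro _ ⟨t, rfl⟩
  exact ⟨⟨C t, hC.1 t⟩, rfl⟩

/-- The affine hull of the reachable part of an orbit is invariant under the reachable
one-parameter groups, so their generators map it to its direction. -/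
lemma apply_mem_direction_of_exp_mem [FiniteDimensional ℝ V] {K : Submonoid (V →L[ℝ] V)}
    {A : V →L[ℝ] V} (hA : ∀ s : ℝ, NormedSpace.exp (s • A) ∈ polynomiallyReachable K) {v x : V}
    (hx : x ∈ affineSpan ℝ (Set.range fun h : polynomiallyReachable K => h.1 v)) :
    A x ∈ (affineSpan ℝ (Set.range fun h : polynomiallyReachable K => h.1 v)).direction := by
  set P := affineSpan ℝ (Set.range fun h : polynomiallyReachable K => h.1 v) with hP
  have : CompleteSpace V := FiniteDimensional.complete ℝ V
  have hinv : ∀ s : ℝ, NormedSpace.exp (s • A) x ∈ P := by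
    intro s
    have hle : P ≤ P.comap (NormedSpace.exp (s • A) : V →L[ℝ] V).toLinearMap.toAffineMap := by
      conv_lhs => rw [hP]
      rw [affineSpan_le]
      rintro _ ⟨h, rfl⟩
      exact mem_affineSpan ℝ ⟨⟨_, mul_mem (hA s) h.2⟩, rfl⟩
    exact hle hx
  have hd : HasDerivAt (fun s : ℝ => NormedSpace.exp (s • A) x) (A x) 0 := by
    have h1 : HasDerivAt (fun s : ℝ => NormedSpace.exp (s • A)) A 0 := by
      simpa using hasDerivAt_exp_smul_const (𝕂 := ℝ) A 0
    exact ((ContinuousLinearMap.apply ℝ V x).hasFDerivAt.comp_hasDerivAt 0 h1)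
  have hclosed : IsClosed (P.direction : Set V) := P.direction.closed_of_finiteDimensional
  refine hclosed.mem_of_tendsto (hasDerivAt_iff_tendsto_slope.1 hd)
    (Eventually.of_forall fun s => ?_)
  exact P.direction.smul_mem _ (AffineSubspace.vsub_mem_direction (hinv s) (hinv 0))

end PolynomialFamily

/-! ### The representation in a chart -/

section LieGroup

variable {E : Type*} [NormedAddCommGroup E] [NormedSpace ℝ E]
  {G : Type*} [Group G]
  {V : Type*} [NormedAddCommGroup V] [NormedSpace ℝ V] [FiniteDimensional ℝ V]
  {ρ : Representation ℝ G V}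

lemma operatorMap_one : operatorMap ρ 1 = 1 := by
  ext x; simp [operatorMap]

lemma operatorMap_mul (g h : G) : operatorMap ρ (g * h) = operatorMap ρ g * operatorMap ρ h := by
  ext x; simp [operatorMap]

variable [TopologicalSpace G] [ChartedSpace E G]

variable (E) in
/-- The representation read in the chart at the identity. -/
noncomputable def chartOperator (ρ : Representation ℝ G V) (x : E) : V →L[ℝ] V :=
  operatorMap ρ ((extChartAt 𝓘(ℝ, E) (1 : G)).symm x)

lemma hasFDerivAt_chartOperator_one (hρ : IsSmoothModule E ρ) :
    HasFDerivAt (chartOperator E ρ) (mfderiv 𝓘(ℝ, E) 𝓘(ℝ, V →L[ℝ] V) (operatorMap ρ) (1 : G) :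
      E →L[ℝ] V →L[ℝ] V) (extChartAt 𝓘(ℝ, E) (1 : G) 1) := by
  have h := ((hρ.mdifferentiable (by simp)) (1 : G)).hasMFDerivAt.2
  rw [ModelWithCorners.range_eq_univ] at h
  exact hasFDerivWithinAt_univ.1 h

/-- The exponentials of the operators by which the Lie algebra acts are limits of operators by
which the group acts. -/
lemma exp_lieAlgebraAction_mem (hρ : IsSmoothModule E ρ) (X : GroupLieAlgebra 𝓘(ℝ, E) G) :
    NormedSpace.exp (lieAlgebraAction ρ X) ∈ closure (Set.range (operatorMap ρ)) := by
  have : CompleteSpace V := FiniteDimensional.complete ℝ V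
  set x₀ := extChartAt 𝓘(ℝ, E) (1 : G) 1 with hx₀
  obtain ⟨Y, hY⟩ : ∃ Y : E, Y = X := ⟨X, rfl⟩
  let f : ℝ → V →L[ℝ] V := fun s => chartOperator E ρ (x₀ + s • Y)
  have h0 : f 0 = 1 := by
    simp only [f, zero_smul, add_zero, chartOperator]
    rw [hx₀, extChartAt_to_inv, operatorMap_one]
  have hf : HasDerivAt f (lieAlgebraAction ρ X) 0 := by
    have h1 : HasDerivAt (fun s : ℝ => x₀ + s • Y) Y 0 := by
      simpa using ((hasDerivAt_id (0 : ℝ)).smul_const Y).const_add x₀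
    have h2 := hasFDerivAt_chartOperator_one hρ
    rw [← hx₀, show x₀ = x₀ + (0 : ℝ) • Y by simp] at h2
    rw [← hY]
    exact h2.comp_hasDerivAt (0 : ℝ) h1
  refine mem_closure_of_tendsto (tendsto_pow_exp h0 hf) (Eventually.of_forall fun n => ?_)
  have hpow : ∀ (g : G) (k : ℕ), operatorMap ρ g ^ k = operatorMap ρ (g ^ k) := by
    intro g k
    induction k with
    | zero => simp [operatorMap_one]
    | succ k ih => rw [pow_succ, pow_succ, operatorMap_mul, ih]
  exact ⟨_, (hpow _ n).symm⟩

variable [LieGroup 𝓘(ℝ, E) ∞ G]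

lemma contDiffOn_chartOperator (hρ : IsSmoothModule E ρ) :
    ContDiffOn ℝ ∞ (chartOperator E ρ) (extChartAt 𝓘(ℝ, E) (1 : G)).target := by
  have : IsManifold 𝓘(ℝ, E) ∞ G := inferInstance
  exact (hρ.comp_contMDiffOn (contMDiffOn_extChartAt_symm (1 : G))).contDiffOn

/-- The derivative of the representation at any point of the chart is, up to left translation,
the action of an element of the Lie algebra. -/
lemma exists_fderiv_chartOperator_eq (hρ : IsSmoothModule E ρ) {x : E}
    (hx : x ∈ (extChartAt 𝓘(ℝ, E) (1 : G)).target) (y : E) :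
    ∃ X : GroupLieAlgebra 𝓘(ℝ, E) G, fderiv ℝ (chartOperator E ρ) x y =
      chartOperator E ρ x * lieAlgebraAction ρ X := by
  set φ := extChartAt 𝓘(ℝ, E) (1 : G)
  set g := φ.symm x with hg
  let ψ : E → G := fun z => g⁻¹ * φ.symm z
  have hψx : ψ x = 1 := by simp [ψ, g]
  have hsymm : MDifferentiableAt 𝓘(ℝ, E) 𝓘(ℝ, E) φ.symm x :=
    ((contMDiffOn_extChartAt_symm (n := ∞) (1 : G)).contMDiffAt
      ((isOpen_extChartAt_target (1 : G)).mem_nhds hx)).mdifferentiableAt (by simp)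
  have hmul : MDifferentiableAt 𝓘(ℝ, E) 𝓘(ℝ, E) (fun h : G => g⁻¹ * h) (φ.symm x) :=
    (contMDiff_mul_left (I := 𝓘(ℝ, E)) (n := ∞) (a := g⁻¹)).mdifferentiable (by simp) _
  have hψ : MDifferentiableAt 𝓘(ℝ, E) 𝓘(ℝ, E) ψ x := hmul.comp x hsymm
  have hop : HasMFDerivAt 𝓘(ℝ, E) 𝓘(ℝ, V →L[ℝ] V) (operatorMap ρ) (ψ x)
      (mfderiv 𝓘(ℝ, E) 𝓘(ℝ, V →L[ℝ] V) (operatorMap ρ) (1 : G) : E →L[ℝ] V →L[ℝ] V) := by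
    rw [hψx]
    exact ((hρ.mdifferentiable (by simp)) (1 : G)).hasMFDerivAt
  have hcomp := (hop.comp x hψ.hasMFDerivAt).hasFDerivAt
  have hR : chartOperator E ρ = fun z => operatorMap ρ g * (operatorMap ρ ∘ ψ) z := by
    funext z
    simp only [chartOperator, Function.comp_apply, ψ]
    rw [← operatorMap_mul, mul_inv_cancel_left]
  refine ⟨(mfderiv 𝓘(ℝ, E) 𝓘(ℝ, E) ψ x : E →L[ℝ] E) y, ?_⟩
  have hfd := (hcomp.const_mul (operatorMap ρ g)).fderiv
  rw [← hR] at hfd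
  rw [hfd]
  rfl

end LieGroup

/-! ### From the Lie algebra to the connected group -/

/-- A homogeneous form of uniqueness for linear differential equations: a bounded function whose
derivative is controlled by the function itself vanishes on a small ball around a zero. -/
lemma eq_zero_of_norm_fderiv_le {E W : Type*} [NormedAddCommGroup E] [NormedSpace ℝ E]
    [NormedAddCommGroup W] [NormedSpace ℝ W] {F : E → W} {x₀ : E} {r C M : ℝ} (hC : 0 ≤ C)
    (hCr : C * r ≤ 1 / 2) (h0 : F x₀ = 0)
    (hF : ∀ x ∈ Metric.ball x₀ r, DifferentiableAt ℝ F x)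
    (hF' : ∀ x ∈ Metric.ball x₀ r, ‖fderiv ℝ F x‖ ≤ C * ‖F x‖)
    (hM : ∀ x ∈ Metric.ball x₀ r, ‖F x‖ ≤ M) : ∀ x ∈ Metric.ball x₀ r, F x = 0 := by
  intro x hx
  have hr : 0 < r := Metric.pos_of_mem_ball hx
  have hM0 : 0 ≤ M := (norm_nonneg _).trans (hM x hx)
  have key : ∀ n : ℕ, ∀ x ∈ Metric.ball x₀ r, ‖F x‖ ≤ M * (1 / 2) ^ n := by
    intro n
    induction n with
    | zero => simpa using hM
    | succ n ih =>
      intro x hx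
      have h1 := (convex_ball x₀ r).norm_image_sub_le_of_norm_fderiv_le (C := C * (M * (1 / 2) ^ n))
        hF (fun z hz => (hF' z hz).trans (by gcongr; exact ih z hz)) (Metric.mem_ball_self hr) hx
      rw [h0, sub_zero] at h1
      have h2 : ‖x - x₀‖ ≤ r := (mem_ball_iff_norm.1 hx).le
      calc ‖F x‖ ≤ C * (M * (1 / 2) ^ n) * ‖x - x₀‖ := h1
        _ ≤ C * (M * (1 / 2) ^ n) * r := by gcongr
        _ = (C * r) * (M * (1 / 2) ^ n) := by ring
        _ ≤ 1 / 2 * (M * (1 / 2) ^ n) := by gcongr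
        _ = M * (1 / 2) ^ (n + 1) := by ring
  have hlim : Tendsto (fun n : ℕ => M * (1 / 2 : ℝ) ^ n) atTop (𝓝 0) := by
    simpa using (tendsto_pow_atTop_nhds_zero_of_lt_one (by norm_num : (0 : ℝ) ≤ 1 / 2)
      (by norm_num)).const_mul M
  exact norm_le_zero_iff.1 (ge_of_tendsto' hlim fun n => key n x hx)

section LieGroup

variable {E : Type*} [NormedAddCommGroup E] [NormedSpace ℝ E]
  {G : Type*} [TopologicalSpace G] [ChartedSpace E G] [Group G]
  [LieGroup 𝓘(ℝ, E) ∞ G]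
  {V : Type*} [NormedAddCommGroup V] [NormedSpace ℝ V] [FiniteDimensional ℝ V]
  {ρ : Representation ℝ G V}

/-- If the Lie algebra maps `U` into `D ≤ U`, then the group elements close to `1` act trivially
on `U` modulo `D`. -/
lemma eventually_sub_mem_of_lieAlgebraAction_mem (hρ : IsSmoothModule E ρ) {D U : Submodule ℝ V}
    (hDU : D ≤ U)
    (hact : ∀ X : GroupLieAlgebra 𝓘(ℝ, E) G, ∀ u ∈ U, lieAlgebraAction ρ X u ∈ D) :
    ∀ᶠ g in 𝓝 (1 : G), ∀ u ∈ U, ρ g u - u ∈ D := by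
  have : IsTopologicalGroup G := topologicalGroup_of_lieGroup 𝓘(ℝ, E) ∞
  set φ := extChartAt 𝓘(ℝ, E) (1 : G)
  obtain ⟨D', hD'⟩ := D.exists_isCompl
  obtain ⟨U', hU'⟩ := U.exists_isCompl
  -- `π` is a projection with kernel `D`, and `e` is a projection onto `U`.
  obtain ⟨π, hπ⟩ : ∃ π : V →L[ℝ] V, ∀ x, π x = 0 ↔ x ∈ D :=
    ⟨LinearMap.toContinuousLinearMap (D'.projection D hD'.symm), fun x => by simp⟩
  obtain ⟨e, heU, hee⟩ : ∃ e : V →L[ℝ] V, (∀ x, e x ∈ U) ∧ ∀ x ∈ U, e x = x :=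
    ⟨LinearMap.toContinuousLinearMap (U.projection U' hU'), fun x => by simp, fun x hx => by
      simpa using hx⟩
  have hopen : IsOpen φ.target := isOpen_extChartAt_target (1 : G)
  have hx₀ : φ 1 ∈ φ.target := mem_extChartAt_target (1 : G)
  have hR := contDiffOn_chartOperator hρ
  have hRd : ∀ x ∈ φ.target, DifferentiableAt ℝ (chartOperator E ρ) x := fun x hx =>
    (hR.contDiffAt (hopen.mem_nhds hx)).differentiableAt (by simp)
  let Rinv : E → V →L[ℝ] V := fun x => operatorMap ρ (φ.symm x)⁻¹
  have hRinv : ∀ x, Rinv x * chartOperator E ρ x = 1 := fun x => by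
    simp only [Rinv, chartOperator]
    rw [← operatorMap_mul, inv_mul_cancel, operatorMap_one]
  have hRinvc : ContinuousAt Rinv (φ 1) :=
    (hρ.continuous.comp continuous_inv).continuousAt.comp
      (continuousAt_extChartAt_symm (1 : G))
  have hR'c : ContinuousAt (fderiv ℝ (chartOperator E ρ)) (φ 1) :=
    (hR.continuousOn_fderiv_of_isOpen hopen (by simp)).continuousAt (hopen.mem_nhds hx₀)
  let Λ : (V →L[ℝ] V) →L[ℝ] V →L[ℝ] V :=
    ((ContinuousLinearMap.mul ℝ (V →L[ℝ] V)).flip e).comp (ContinuousLinearMap.mul ℝ _ π)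
  have hΛ : ∀ B x, Λ B x = π (B (e x)) := fun B x => rfl
  let F : E → V →L[ℝ] V := fun x => Λ (chartOperator E ρ x - 1)
  have hFd : ∀ x ∈ φ.target, HasFDerivAt F (Λ.comp (fderiv ℝ (chartOperator E ρ) x)) x :=
    fun x hx => Λ.hasFDerivAt.comp x ((hRd x hx).hasFDerivAt.sub_const 1)
  -- The derivative of `F` is obtained from `F` by right multiplication with `A * e`, where `A`
  -- belongs to the Lie algebra.
  have hFA : ∀ x ∈ φ.target, ∀ y, Λ (fderiv ℝ (chartOperator E ρ) x y) =
      F x * (Rinv x * fderiv ℝ (chartOperator E ρ) x y * e) := by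
    intro x hx y
    obtain ⟨X, hX⟩ := exists_fderiv_chartOperator_eq hρ hx y
    rw [hX, ← mul_assoc (Rinv x), hRinv, one_mul]
    ext z
    have hz : lieAlgebraAction ρ X (e z) ∈ D := hact X _ (heU z)
    have h1 : π (lieAlgebraAction ρ X (e z)) = 0 := (hπ _).2 hz
    simp only [F, hΛ, mul_apply_eq_comp, hee _ (hDU hz), sub_apply,
      map_sub, one_apply_eq_self, h1, sub_zero]
  set c : ℝ := ‖Rinv (φ 1)‖ * ‖fderiv ℝ (chartOperator E ρ) (φ 1)‖ * ‖e‖ + 1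
  have hc : 0 < c := by positivity
  have hev : ∀ᶠ x in 𝓝 (φ 1), x ∈ φ.target ∧
      ‖Rinv x‖ * ‖fderiv ℝ (chartOperator E ρ) x‖ * ‖e‖ ≤ c ∧ ‖F x‖ ≤ ‖F (φ 1)‖ + 1 := by
    refine Filter.Eventually.and (hopen.mem_nhds hx₀) (Filter.Eventually.and ?_ ?_)
    · have hnorm : Tendsto (fun x => ‖fderiv ℝ (chartOperator E ρ) x‖) (𝓝 (φ 1))
          (𝓝 ‖fderiv ℝ (chartOperator E ρ) (φ 1)‖) :=
        (continuous_norm (E := E →L[ℝ] V →L[ℝ] V)).continuousAt.comp hR'c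
      exact ((Tendsto.norm hRinvc).mul hnorm |>.mul_const ‖e‖).eventually_le_const (lt_add_one _)
    · exact (hFd _ hx₀).continuousAt.norm.eventually_le_const (lt_add_one _)
  obtain ⟨r₀, hr₀, hball⟩ := Metric.eventually_nhds_iff_ball.1 hev
  set r := min r₀ (1 / (2 * c))
  have hr : 0 < r := lt_min hr₀ (by positivity)
  have hsub : ∀ x ∈ Metric.ball (φ 1) r, x ∈ Metric.ball (φ 1) r₀ := fun x hx =>
    Metric.ball_subset_ball (min_le_left _ _) hx
  have hzero : ∀ x ∈ Metric.ball (φ 1) r, F x = 0 := by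
    refine eq_zero_of_norm_fderiv_le hc.le ?_ ?_
      (fun x hx => (hFd x (hball x (hsub x hx)).1).differentiableAt) (fun x hx => ?_)
      fun x hx => (hball x (hsub x hx)).2.2
    · calc c * r ≤ c * (1 / (2 * c)) := by gcongr; exact min_le_right _ _
        _ = 1 / 2 := by field_simp
    · simp only [F, chartOperator]
      rw [extChartAt_to_inv, operatorMap_one, sub_self, map_zero]
    · obtain ⟨hxt, hxc, -⟩ := hball x (hsub x hx)
      rw [(hFd x hxt).fderiv]
      refine ContinuousLinearMap.opNorm_le_bound _ (by positivity) fun y => ?_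
      rw [ContinuousLinearMap.comp_apply, hFA x hxt]
      calc ‖F x * (Rinv x * fderiv ℝ (chartOperator E ρ) x y * e)‖
          ≤ ‖F x‖ * (‖Rinv x‖ * (‖fderiv ℝ (chartOperator E ρ) x‖ * ‖y‖) * ‖e‖) := by
            refine (norm_mul_le _ _).trans ?_
            gcongr
            refine (norm_mul_le _ _).trans ?_
            gcongr
            refine (norm_mul_le _ _).trans ?_
            gcongr
            exact ContinuousLinearMap.le_opNorm _ _
        _ = (‖Rinv x‖ * ‖fderiv ℝ (chartOperator E ρ) x‖ * ‖e‖) * ‖F x‖ * ‖y‖ := by ring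
        _ ≤ c * ‖F x‖ * ‖y‖ := by gcongr
  filter_upwards [extChartAt_source_mem_nhds (I := 𝓘(ℝ, E)) (1 : G),
    (continuousAt_extChartAt (I := 𝓘(ℝ, E)) (1 : G)).preimage_mem_nhds
      (Metric.ball_mem_nhds _ hr)] with g hg hgr u hu
  have h1 := DFunLike.congr_fun (show F (φ g) = 0 from hzero _ hgr) u
  have h2 : chartOperator E ρ (φ g) = operatorMap ρ g := by
    simp only [chartOperator]
    rw [φ.left_inv hg]
  simp only [F, hΛ, h2, hee u hu] at h1
  exact (hπ _).1 h1

/-- If the Lie algebra maps `U` into `D ≤ U`, then the connected group acts trivially on `U`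
modulo `D`. -/
lemma sub_mem_of_lieAlgebraAction_mem [ConnectedSpace G] (hρ : IsSmoothModule E ρ)
    {D U : Submodule ℝ V} (hDU : D ≤ U)
    (hact : ∀ X : GroupLieAlgebra 𝓘(ℝ, E) G, ∀ u ∈ U, lieAlgebraAction ρ X u ∈ D)
    (g : G) {u : V} (hu : u ∈ U) : ρ g u - u ∈ D := by
  have : IsTopologicalGroup G := topologicalGroup_of_lieGroup 𝓘(ℝ, E) ∞
  have hmul : ∀ {a b : G}, (∀ u ∈ U, ρ a u - u ∈ D) → (∀ u ∈ U, ρ b u - u ∈ D) →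
      ∀ u ∈ U, ρ (a * b) u - u ∈ D := by
    intro a b ha hb u hu
    have h1 := hb u hu
    have h2 := D.add_mem (D.add_mem (ha _ (hDU h1)) h1) (ha u hu)
    convert h2 using 1
    rw [map_mul, Module.End.mul_apply, map_sub]
    abel
  let S : Subgroup G :=
    { carrier := {g | (∀ u ∈ U, ρ g u - u ∈ D) ∧ ∀ u ∈ U, ρ g⁻¹ u - u ∈ D}
      one_mem' := by simp
      mul_mem' := fun {a b} ha hb => ⟨hmul ha.1 hb.1, by
        rw [mul_inv_rev]; exact hmul hb.2 ha.2⟩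
      inv_mem' := fun {a} ha => ⟨ha.2, by rw [inv_inv]; exact ha.1⟩ }
  have hnhds : (S : Set G) ∈ 𝓝 (1 : G) := by
    have h1 := eventually_sub_mem_of_lieAlgebraAction_mem hρ hDU hact
    have h2 : Tendsto (fun g : G => g⁻¹) (𝓝 1) (𝓝 1) := by
      simpa using (continuous_inv (G := G)).tendsto 1
    exact h1.and (h2.eventually h1)
  have hopen : IsOpen (S : Set G) := S.isOpen_of_mem_nhds hnhds
  have huniv : (S : Set G) = Set.univ :=
    IsClopen.eq_univ ⟨S.isClosed_of_isOpen hopen, hopen⟩ ⟨1, S.one_mem⟩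
  have hg : g ∈ (S : Set G) := huniv ▸ Set.mem_univ g
  exact hg.1 u hu

end LieGroup

end Bohr

theorem theorem2
    {E : Type*} [NormedAddCommGroup E] [NormedSpace ℝ E] [FiniteDimensional ℝ E]
    {G : Type*} [TopologicalSpace G] [T2Space G] [ChartedSpace E G] [Group G]
    [LieGroup 𝓘(ℝ, E) ∞ G] [ConnectedSpace G] [Group.IsNilpotent G]
    {V : Type*} [NormedAddCommGroup V] [NormedSpace ℝ V] [FiniteDimensional ℝ V]
    (ρ : Representation ℝ G V) (hρ : Bohr.IsSmoothModule E ρ)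
    (hu : Bohr.IsUnipotentType E ρ) (v : V) :
    Bohr.IsBohrDenseIn (Set.range fun g : G => ρ g v)
      (affineSpan ℝ (Set.range fun g : G => ρ g v) : Set V) := by
  refine ⟨subset_affineSpan ℝ _, ?_⟩
  let M : Submonoid (V →L[ℝ] V) :=
    { carrier := Set.range (Bohr.operatorMap ρ)
      one_mem' := ⟨1, Bohr.operatorMap_one⟩
      mul_mem' := by
        rintro _ _ ⟨g, rfl⟩ ⟨h, rfl⟩
        exact ⟨g * h, Bohr.operatorMap_mul g h⟩ }
  let K := M.topologicalClosure
  have hexp : ∀ X : GroupLieAlgebra 𝓘(ℝ, E) G, ∀ s : ℝ,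
      NormedSpace.exp (s • Bohr.lieAlgebraAction ρ X) ∈ Bohr.polynomiallyReachable K := by
    intro X s
    have hsmul : ∀ s : ℝ, s • Bohr.lieAlgebraAction ρ X = Bohr.lieAlgebraAction ρ (s • X) :=
      fun s => (map_smul _ s X).symm
    rw [hsmul]
    refine Bohr.exp_mem_polynomiallyReachable (hu _) fun t => ?_
    have hsmul' : t • Bohr.lieAlgebraAction ρ (s • X) = Bohr.lieAlgebraAction ρ (t • s • X) :=
      (map_smul _ t (s • X)).symm
    rw [hsmul']
    exact Bohr.exp_lieAlgebraAction_mem hρ _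
  set P := affineSpan ℝ (Set.range fun h : Bohr.polynomiallyReachable K => h.1 v)
  have hvP : v ∈ P := mem_affineSpan ℝ ⟨1, rfl⟩
  have hDU : P.direction ≤ Submodule.span ℝ (P : Set V) := by
    rw [AffineSubspace.direction_eq_vectorSpan, vectorSpan_def, Submodule.span_le]
    rintro _ ⟨x, hx, y, hy, rfl⟩
    exact Submodule.sub_mem _ (Submodule.subset_span hx) (Submodule.subset_span hy)
  have hact : ∀ X : GroupLieAlgebra 𝓘(ℝ, E) G, ∀ u ∈ Submodule.span ℝ (P : Set V),
      Bohr.lieAlgebraAction ρ X u ∈ P.direction := by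
    intro X u hu
    have hle : Submodule.span ℝ (P : Set V) ≤
        P.direction.comap (Bohr.lieAlgebraAction ρ X : V →ₗ[ℝ] V) :=
      Submodule.span_le.2 fun x hx => Bohr.apply_mem_direction_of_exp_mem (hexp X) hx
    exact hle hu
  have hGP : affineSpan ℝ (Set.range fun g : G => ρ g v) ≤ P := by
    rw [affineSpan_le]
    rintro _ ⟨g, rfl⟩
    have h := Bohr.sub_mem_of_lieAlgebraAction_mem hρ hDU hact g (Submodule.subset_span hvP)
    simpa using AffineSubspace.vadd_mem_of_mem_direction h hvP
  intro w hw
  have h1 := Bohr.affineSpan_reachable_subset_bohr_closure K v (hGP hw)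
  -- The norm closure of the orbit lies in its Bohr closure.
  refine @closure_minimal V (Bohr.bohrTopology V) _ _ ?_
    (@isClosed_closure V (Bohr.bohrTopology V) _) _ h1
  rintro _ ⟨⟨h, hh⟩, rfl⟩
  have h2 : h v ∈ closure (Set.range fun g : G => ρ g v) := by
    refine map_mem_closure (f := fun B : V →L[ℝ] V => B v) (by fun_prop) hh ?_
    rintro _ ⟨g, rfl⟩
    exact ⟨g, rfl⟩
  exact closure.mono (Bohr.le_bohrTopology V) h2
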